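/- Let $\mathcal{G}=(\mathcal{V},\mathcal{E},W)$ be a finite strongly connected weighted digraph with nonnegative weighted adjacency matrix $W$ ($W_{ij}>0$ exactly when there is an arc from $i$ to $j$; every vertex is reachable from every other vertex). Let $d_i=\sum_{j}W_{ij}$ be the (out-)degree of $i$, let $d_{\mathcal{G}}=\sum_i d_i$ be the volume of $\mathcal{G}$, and consider the random walk on $\mathcal{G}$ that jumps from $i$ to $j$ with probability $P_{ij}=W_{ij}/d_i$. Let $\pi$ be its stationary distribution. For a vertex $i$ and a set $\mathcal{X}\subseteq\mathcal{V}$, let $P_{\mathrm{es}}(i,\mathcal{X})$ be the probability that the walk started at $i$ reaches some vertex of $\mathcal{X}$ before it returns to $i$. For nonempty $\mathcal{X}$ put $$\Omega(i,\mathcal{X})=\frac{1}{d_{\mathcal{G}}\,\pi_i\,P_{\mathrm{es}}(i,\mathcal{X})}\quad\text{if } i\notin\mathcal{X},\qquad \Omega(i,\mathcal{X})=0\quad\text{if } i\in\mathcal{X},$$ and define the resistance distance of the vertex group $\mathcal{X}$ as $\Omega(\mathcal{X})=\sum_{i\in\mathcal{V}}\Omega(i,\mathcal{X})$. Then $\Omega$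 is a monotone decreasing and supermodular function of the nonempty set $\mathcal{X}$: for all nonempty vertex sets $\mathcal{X}\subseteq\mathcal{Y}\subseteq\mathcal{V}$, $$\Omega(\mathcal{X})\ \ge\ \Omega(\mathcal{Y}),$$ and, for every vertex $i\in\mathcal{V}$ (in particular for every $i\notin\mathcal{Y}$), $$\Omega(\mathcal{X})-\Omega(\mathcal{X}\cup\{i\})\ \ge\ \Omega(\mathcal{Y})-\Omega(\mathcal{Y}\cup\{i\}).$$ -/

import Mathlib

open MeasureTheory ProbabilityTheory Finset

/-- A weighted digraph on the vertex set `V`: a nonnegative weighted adjacency matrix, where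
`weight i j > 0` exactly when there is an arc from `i` to `j`. -/
structure WeightedDigraph (V : Type*) where
  weight : Matrix V V ℝ
  weight_nonneg : ∀ i j, 0 ≤ weight i j

namespace WeightedDigraph

/-- There is an arc from `i` to `j`. -/
def Arc {V : Type*} (G : WeightedDigraph V) (i j : V) : Prop := 0 < G.weight i j

/-- Every vertex is reachable from every other vertex along arcs. -/
def StronglyConnected {V : Type*} (G : WeightedDigraph V) : Prop :=
  ∀ i j : V, Relation.ReflTransGen G.Arc i j

/-- The (out-)degree of a vertex. -/
noncomputable def degree {V : Type*} [Fintype V] (G : WeightedDigraph V) (i : V) : ℝ :=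
  ∑ j, G.weight i j

/-- The volume of the digraph, the sum of all degrees. -/
noncomputable def volume {V : Type*} [Fintype V] (G : WeightedDigraph V) : ℝ :=
  ∑ i, G.degree i

/-- The transition matrix `D⁻¹ W`, with `D` the diagonal matrix of degrees. -/
noncomputable def transition {V : Type*} [Fintype V] (G : WeightedDigraph V) : Matrix V V ℝ :=
  Matrix.of fun i j => G.weight i j / G.degree i

theorem transition_apply {V : Type*} [Fintype V] (G : WeightedDigraph V) (i j : V) :
    G.transition i j = G.weight i j / G.degree i := rfl

theorem degree_nonneg {V : Type*} [Fintype V] (G : WeightedDigraph V) (i : V) :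
    0 ≤ G.degree i := Finset.sum_nonneg fun j _ => G.weight_nonneg i j

theorem transition_nonneg {V : Type*} [Fintype V] (G : WeightedDigraph V) (i j : V) :
    0 ≤ G.transition i j := div_nonneg (G.weight_nonneg i j) (G.degree_nonneg i)

theorem sum_transition {V : Type*} [Fintype V] (G : WeightedDigraph V) (i : V)
    (h : G.degree i ≠ 0) : ∑ j, G.transition i j = 1 := by
  simp only [transition_apply, ← Finset.sum_div]
  exact div_self h

/-! ### The stationary distribution -/

/-- `π` is a probability vector on the vertices that is invariant under one step of the walk. -/
structure IsStationary {V : Type*} [Fintype V] (G : WeightedDigraph V) (π : V → ℝ) : Prop where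
  nonneg : ∀ i, 0 ≤ π i
  sum_eq_one : ∑ i, π i = 1
  invariant : Matrix.vecMul π G.transition = π

/-- A nonnegative invariant vector with a positive entry is positive everywhere. -/
theorem pos_of_invariant {V : Type*} [Fintype V] (G : WeightedDigraph V)
    (hG : G.StronglyConnected) (hd : ∀ i, 0 < G.degree i) {π : V → ℝ} (h0 : ∀ i, 0 ≤ π i)
    (hinv : Matrix.vecMul π G.transition = π) {i : V} (hi : 0 < π i) (j : V) : 0 < π j := by
  induction hG i j with
  | refl => exact hi
  | @tail b c _ hbc ih =>
    have h1 : π c = ∑ k, π k * G.transition k c := by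
      conv_lhs => rw [← hinv]
      rfl
    rw [h1]
    have hP : 0 < G.transition b c := div_pos hbc (hd b)
    exact (mul_pos ih hP).trans_le
      (Finset.single_le_sum (f := fun k => π k * G.transition k c)
        (fun k _ => mul_nonneg (h0 k) (G.transition_nonneg k c)) (Finset.mem_univ b))

theorem exists_isStationary {V : Type*} [Fintype V] [Nonempty V] (G : WeightedDigraph V)
    (hd : ∀ i, 0 < G.degree i) : ∃ π, G.IsStationary π := by
  classical
  have hdet : (1 - G.transition).det = 0 := by
    refine Matrix.exists_mulVec_eq_zero_iff.1 ⟨fun _ => 1, ?_, ?_⟩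
    · obtain ⟨i⟩ := ‹Nonempty V›
      exact fun h => one_ne_zero (congrFun h i)
    · ext i
      have h1 : Matrix.mulVec G.transition (fun _ => (1 : ℝ)) i = 1 := by
        simp [Matrix.mulVec, dotProduct, G.sum_transition i (hd i).ne']
      rw [Matrix.sub_mulVec, Matrix.one_mulVec, Pi.sub_apply, h1, sub_self, Pi.zero_apply]
  obtain ⟨v, hv0, hv⟩ := Matrix.exists_vecMul_eq_zero_iff.2 hdet
  rw [Matrix.vecMul_sub, Matrix.vecMul_one, sub_eq_zero] at hv
  have hle : ∀ j ∈ Finset.univ, |v j| ≤ ∑ i, |v i| * G.transition i j := fun j _ => by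
    have h1 : v j = ∑ k, v k * G.transition k j := congrFun hv j
    rw [h1]
    refine (Finset.abs_sum_le_sum_abs _ _).trans (le_of_eq ?_)
    refine Finset.sum_congr rfl fun i _ => ?_
    rw [abs_mul, abs_of_nonneg (G.transition_nonneg i j)]
  have hsum : ∑ j, |v j| = ∑ j, ∑ i, |v i| * G.transition i j := by
    rw [Finset.sum_comm]
    refine Finset.sum_congr rfl fun i _ => ?_
    rw [← Finset.mul_sum, G.sum_transition i (hd i).ne', mul_one]
  have heq := (Finset.sum_eq_sum_iff_of_le hle).1 hsum
  have hS : 0 < ∑ i, |v i| := by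
    obtain ⟨i, hi⟩ := Function.ne_iff.1 hv0
    exact (abs_pos.2 hi).trans_le
      (Finset.single_le_sum (f := fun i => |v i|) (fun _ _ => abs_nonneg _) (Finset.mem_univ i))
  refine ⟨fun i => |v i| / ∑ k, |v k|, fun i => by positivity, ?_, ?_⟩
  · rw [← Finset.sum_div, div_self hS.ne']
  · ext j
    show ∑ i, |v i| / (∑ k, |v k|) * G.transition i j = _
    rw [heq j (Finset.mem_univ j), Finset.sum_div]
    exact Finset.sum_congr rfl fun i _ => by ring

theorem IsStationary.unique {V : Type*} [Fintype V] {G : WeightedDigraph V}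
    (hG : G.StronglyConnected) (hd : ∀ i, 0 < G.degree i) {π ρ : V → ℝ}
    (hπ : G.IsStationary π) (hρ : G.IsStationary ρ) : ρ = π := by
  have hpos : ∀ i, 0 < π i := by
    obtain ⟨i, -, hi⟩ : ∃ i ∈ Finset.univ, 0 < π i := by
      by_contra! h
      have := Finset.sum_nonpos h
      rw [hπ.sum_eq_one] at this
      linarith
    exact G.pos_of_invariant hG hd hπ.nonneg hπ.invariant hi
  have hne : (Finset.univ : Finset V).Nonempty := by
    by_contra h
    have := hπ.sum_eq_one
    rw [Finset.not_nonempty_iff_eq_empty.1 h] at this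
    simp at this
  obtain ⟨m, -, hm⟩ := Finset.exists_min_image Finset.univ (fun i => ρ i / π i) hne
  set c := ρ m / π m with hc
  have hσ0 : ∀ i, 0 ≤ (ρ - c • π) i := fun i => by
    have := (le_div_iff₀ (hpos i)).1 (hm i (Finset.mem_univ i))
    simpa using this
  have hσ : Matrix.vecMul (ρ - c • π) G.transition = ρ - c • π := by
    rw [Matrix.sub_vecMul, Matrix.smul_vecMul, hπ.invariant, hρ.invariant]
  have hσm : (ρ - c • π) m = 0 := by
    have := (hpos m).ne'
    simp [hc, div_mul_cancel₀ _ this]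
  have hρc : ρ = c • π := by
    ext i
    by_contra hi
    have hi' : 0 < (ρ - c • π) i :=
      lt_of_le_of_ne (hσ0 i) fun h => hi (sub_eq_zero.1 (by simpa using h.symm))
    exact (G.pos_of_invariant hG hd hσ0 hσ hi' m).ne' hσm
  have hc1 : c = 1 := by
    have h1 := hρ.sum_eq_one
    rw [hρc] at h1
    simpa [← Finset.mul_sum, hπ.sum_eq_one] using h1
  rw [hρc, hc1, one_smul]

open Classical in
/-- The stationary distribution of the random walk. By `isStationary_stationary` and
`IsStationary.unique` it exists and is unique on every strongly connected digraph with positive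
degrees, in particular on every one with at least two vertices. The value `0` is used only if there
is no stationary distribution, as for a single vertex without a loop. -/
noncomputable def stationary {V : Type*} [Fintype V] (G : WeightedDigraph V) : V → ℝ :=
  if h : ∃ π, G.IsStationary π then h.choose else 0

theorem isStationary_stationary {V : Type*} [Fintype V] [Nonempty V] (G : WeightedDigraph V)
    (hd : ∀ i, 0 < G.degree i) : G.IsStationary G.stationary := by
  have h := G.exists_isStationary hd
  rw [stationary, dif_pos h]
  exact h.choose_spec

/-- On a strongly connected digraph with at least two vertices all degrees are positive. -/
theorem StronglyConnected.degree_pos {V : Type*} [Fintype V] [Nontrivial V]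
    {G : WeightedDigraph V} (hG : G.StronglyConnected) (i : V) : 0 < G.degree i := by
  obtain ⟨j, hj⟩ := exists_ne i
  rcases (hG i j).cases_head with h | ⟨k, hk, -⟩
  · exact absurd h.symm hj
  · exact lt_of_lt_of_le hk
      (Finset.single_le_sum (f := fun j => G.weight i j) (fun j _ => G.weight_nonneg i j)
        (Finset.mem_univ k))

/-! ### The random walk -/

open Classical in
/-- The law of one step of the random walk from `i`: it jumps to `j` with probability
`G.transition i j`. From a vertex of degree `0`, where there is no transition, it stays put. -/
noncomputable def stepLaw {V : Type*} [Fintype V] [MeasurableSpace V]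
    (G : WeightedDigraph V) (i : V) : Measure V :=
  if G.degree i = 0 then Measure.dirac i
  else ∑ j, ENNReal.ofReal (G.transition i j) • Measure.dirac j

theorem isProbabilityMeasure_stepLaw {V : Type*} [Fintype V] [MeasurableSpace V]
    (G : WeightedDigraph V) (i : V) : IsProbabilityMeasure (G.stepLaw i) := by
  unfold stepLaw
  split_ifs with h
  · infer_instance
  · constructor
    simp only [Measure.coe_finsetSum, Measure.coe_smul, Finset.sum_apply, Pi.smul_apply,
      measure_univ, smul_eq_mul, mul_one]
    rw [← ENNReal.ofReal_sum_of_nonneg fun j _ => G.transition_nonneg i j,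
      G.sum_transition i h, ENNReal.ofReal_one]

/-- One step of the walk from the last vertex of a trajectory known up to time `n`. -/
noncomputable def stepKernel {V : Type*} [Fintype V] [MeasurableSpace V]
    [MeasurableSingletonClass V] (G : WeightedDigraph V) (n : ℕ) :
    Kernel ((_ : Finset.Iic n) → V) V where
  toFun h := G.stepLaw (h ⟨n, Finset.mem_Iic.2 le_rfl⟩)
  measurable' := (measurable_of_countable G.stepLaw).comp (measurable_pi_apply _)

instance {V : Type*} [Fintype V] [MeasurableSpace V] [MeasurableSingletonClass V]
    (G : WeightedDigraph V) (n : ℕ) : IsMarkovKernel (G.stepKernel n) :=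
  ⟨fun _ => G.isProbabilityMeasure_stepLaw _⟩

/-- The law, on the space of trajectories `ℕ → V`, of the random walk started at `i`. -/
noncomputable def walkLaw {V : Type*} [Fintype V] [MeasurableSpace V]
    [MeasurableSingletonClass V] (G : WeightedDigraph V) (i : V) : Measure (ℕ → V) :=
  Kernel.traj (X := fun _ => V) G.stepKernel 0 fun _ => i

/-! ### Escape probability and resistance distance -/

/-- The probability that the random walk started at `i` reaches some vertex of `X` before it
returns to `i`. -/
noncomputable def escapeProb {V : Type*} [Fintype V] [MeasurableSpace V]
    [MeasurableSingletonClass V] (G : WeightedDigraph V) (i : V) (X : Finset V) : ℝ :=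
  (G.walkLaw i).real {ω | ∃ t, 1 ≤ t ∧ ω t ∈ X ∧ ∀ s, 1 ≤ s → s ≤ t → ω s ≠ i}

/-- The resistance distance between a vertex and a group of vertices: the reciprocal of
`volume * stationary i * escapeProb i X` for `i ∉ X`, and `0` for `i ∈ X`. -/
noncomputable def resistance {V : Type*} [Fintype V] [DecidableEq V] [MeasurableSpace V]
    [MeasurableSingletonClass V] (G : WeightedDigraph V) (i : V) (X : Finset V) : ℝ :=
  if i ∈ X then 0 else 1 / (G.volume * G.stationary i * G.escapeProb i X)

/-- The resistance distance of a group of vertices, the sum over all vertices of the resistance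
distance to the group. -/
noncomputable def groupResistance {V : Type*} [Fintype V] [DecidableEq V] [MeasurableSpace V]
    [MeasurableSingletonClass V] (G : WeightedDigraph V) (X : Finset V) : ℝ :=
  ∑ i, G.resistance i X

end WeightedDigraph

/-! For `i ∉ X`, the number of visits to `i` before `X` of the walk from `i` is geometric with
success probability `P_es(i, X)`, so its mean `g_X(i, i)` is `1 / P_es(i, X)`. Hence `Ω(i, X)` is
`g_X(i, i)` times a nonnegative factor that does not depend on `X`, also when `i ∈ X`, because the
Green function vanishes there (`IsGreen.resistance_eq`). It remains to show that the Green function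
with a fixed pole is decreasing and supermodular in `X`.

This is potential theory. The Green function solves a Dirichlet problem, zero on `X` and `g = δ_k +
P g` off `X`. In first and second differences over `X` the source `δ_k` cancels, so these are
harmonic off the largest killing set involved, and the maximum principle reduces the claim to
boundary values. There monotonicity follows from `g ≥ 0` (`IsGreen.antitone`), and supermodularity
from monotonicity (`IsGreen.supermodular`).

Probability enters only in `IsGreen.escapeProb_eq_inv`, through a harmonic function followed along
the walk until it hits `X` or returns to `i`. -/

namespace WeightedDigraph

/-! ### The maximum principle and the Green function -/

/-- The mean of `f` after one step of the walk from `v`. -/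
noncomputable def stepMean {V : Type*} [Fintype V] (G : WeightedDigraph V) (f : V → ℝ) (v : V) :
    ℝ := ∑ j, G.transition v j * f j

theorem stepMean_add {V : Type*} [Fintype V] (G : WeightedDigraph V) (f g : V → ℝ) (v : V) :
    G.stepMean (f + g) v = G.stepMean f v + G.stepMean g v := by
  simp [stepMean, mul_add, Finset.sum_add_distrib]

theorem stepMean_sub {V : Type*} [Fintype V] (G : WeightedDigraph V) (f g : V → ℝ) (v : V) :
    G.stepMean (f - g) v = G.stepMean f v - G.stepMean g v := by
  simp [stepMean, mul_sub, Finset.sum_sub_distrib]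

theorem stepMean_smul {V : Type*} [Fintype V] (G : WeightedDigraph V) (c : ℝ) (f : V → ℝ)
    (v : V) : G.stepMean (c • f) v = c * G.stepMean f v := by
  simp only [stepMean, Finset.mul_sum, Pi.smul_apply, smul_eq_mul]
  exact Finset.sum_congr rfl fun j _ => by ring

theorem stepMean_const {V : Type*} [Fintype V] (G : WeightedDigraph V) (c : ℝ) {v : V}
    (hd : 0 < G.degree v) : G.stepMean (fun _ => c) v = c := by
  rw [stepMean, ← Finset.sum_mul, G.sum_transition v hd.ne', one_mul]

theorem stepMean_nonneg {V : Type*} [Fintype V] (G : WeightedDigraph V) {f : V → ℝ}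
    (hf : ∀ v, 0 ≤ f v) (v : V) : 0 ≤ G.stepMean f v :=
  Finset.sum_nonneg fun j _ => mul_nonneg (G.transition_nonneg v j) (hf j)

/-- The maximum principle: a function that is subharmonic off a nonempty set `X` and nonpositive
on `X` is nonpositive. -/
theorem nonpos_of_le_stepMean {V : Type*} [Fintype V] {G : WeightedDigraph V}
    (hG : G.StronglyConnected) (hd : ∀ i, 0 < G.degree i) {X : Finset V} (hX : X.Nonempty)
    {f : V → ℝ} (hfX : ∀ v ∈ X, f v ≤ 0) (hf : ∀ v ∉ X, f v ≤ G.stepMean f v) (v : V) :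
    f v ≤ 0 := by
  obtain ⟨m, -, hm⟩ := Finset.exists_max_image Finset.univ f ⟨v, Finset.mem_univ v⟩
  by_contra! hv
  have hm0 : 0 < f m := hv.trans_le (hm v (Finset.mem_univ v))
  obtain ⟨x, hx⟩ := hX
  -- The positive maximum spreads along arcs: a vertex attaining it lies off `X`, and a smaller
  -- value at a successor would push the mean strictly below it. Strong connectivity then carries it
  -- into `X`, a contradiction.
  have key : ∀ w, Relation.ReflTransGen G.Arc m w → f w = f m := fun w hw => by
    induction hw with
    | refl => rfl
    | @tail b c _ hbc ih =>
      by_contra hne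
      have hlt : f c < f m := lt_of_le_of_ne (hm c (Finset.mem_univ c)) hne
      have hb : b ∉ X := fun h => by linarith [hfX b h]
      have h1 : G.stepMean f b < G.stepMean (fun _ => f m) b := by
        refine Finset.sum_lt_sum (fun j _ => mul_le_mul_of_nonneg_left (hm j (Finset.mem_univ j))
          (G.transition_nonneg b j)) ⟨c, Finset.mem_univ c, ?_⟩
        exact mul_lt_mul_of_pos_left hlt (div_pos hbc (hd b))
      rw [G.stepMean_const _ (hd b)] at h1
      linarith [hf b hb]
  linarith [hfX x hx, key x (hG m x)]

/-- The maximum principle for `f` and `-f` gives uniqueness, and in finite dimension an injective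
endomorphism is surjective. -/
theorem exists_dirichlet {V : Type*} [Fintype V] {G : WeightedDigraph V}
    (hG : G.StronglyConnected) (hd : ∀ i, 0 < G.degree i) {X : Finset V} (hX : X.Nonempty)
    (b : V → ℝ) :
    ∃ g : V → ℝ, (∀ v ∈ X, g v = 0) ∧ ∀ v ∉ X, g v = b v + G.stepMean g v := by
  classical
  let T : (V → ℝ) →ₗ[ℝ] (V → ℝ) :=
    { toFun := fun f v => if v ∈ X then f v else f v - G.stepMean f v
      map_add' := fun f g => by
        ext v
        by_cases hv : v ∈ X <;> simp [hv, stepMean_add]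
        ring
      map_smul' := fun c f => by
        ext v
        by_cases hv : v ∈ X <;> simp [hv, stepMean_smul, mul_sub] }
  have hT : ∀ f v, T f v = if v ∈ X then f v else f v - G.stepMean f v := fun _ _ => rfl
  have hle : ∀ f, T f = 0 → ∀ v, f v ≤ 0 := fun f hf =>
    nonpos_of_le_stepMean hG hd hX
      (fun v hv => by
        have := congrFun hf v
        rw [hT, if_pos hv] at this
        exact this.le)
      (fun v hv => by
        have := congrFun hf v
        rw [hT, if_neg hv, Pi.zero_apply] at this
        linarith)
  have hinj : Function.Injective T := by
    rw [← LinearMap.ker_eq_bot, LinearMap.ker_eq_bot']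
    intro f hf
    ext v
    refine le_antisymm (hle f hf v) ?_
    have := hle (-f) (by rw [map_neg, hf, neg_zero]) v
    simpa using this
  obtain ⟨g, hg⟩ := LinearMap.injective_iff_surjective.1 hinj fun v => if v ∈ X then 0 else b v
  refine ⟨g, fun v hv => ?_, fun v hv => ?_⟩
  · have := congrFun hg v
    simpa [hT, hv] using this
  · have := congrFun hg v
    simp only [hT, hv, if_false] at this
    linarith

open Classical in
/-- `g` is the Green function with pole `k` of the walk killed on `X`: the value at `v` is the
mean number of visits to `k` before `X` of the walk started at `v`. -/
structure IsGreen {V : Type*} [Fintype V] (G : WeightedDigraph V) (X : Finset V) (k : V)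
    (g : V → ℝ) : Prop where
  eq_zero : ∀ v ∈ X, g v = 0
  eq_add : ∀ v ∉ X, g v = (if v = k then 1 else 0) + G.stepMean g v

theorem exists_isGreen {V : Type*} [Fintype V] {G : WeightedDigraph V}
    (hG : G.StronglyConnected) (hd : ∀ i, 0 < G.degree i) {X : Finset V} (hX : X.Nonempty)
    (k : V) : ∃ g, G.IsGreen X k g := by
  classical
  obtain ⟨g, h0, h1⟩ := exists_dirichlet hG hd hX fun v => if v = k then 1 else 0
  exact ⟨g, h0, fun v hv => by convert h1 v hv⟩

theorem IsGreen.nonneg {V : Type*} [Fintype V] {G : WeightedDigraph V}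
    (hG : G.StronglyConnected) (hd : ∀ i, 0 < G.degree i) {X : Finset V} (hX : X.Nonempty)
    {k : V} {g : V → ℝ} (hg : G.IsGreen X k g) (v : V) : 0 ≤ g v := by
  have := nonpos_of_le_stepMean hG hd hX (f := (-1 : ℝ) • g)
    (fun v hv => by simp [hg.eq_zero v hv])
    (fun v hv => by
      rw [stepMean_smul, Pi.smul_apply, smul_eq_mul, hg.eq_add v hv]
      split_ifs <;> linarith) v
  simpa using this

/-- Off `Y` the sources cancel, so `g' - g` is harmonic there; on `Y` it equals `-g ≤ 0`. -/
theorem IsGreen.antitone {V : Type*} [Fintype V] {G : WeightedDigraph V}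
    (hG : G.StronglyConnected) (hd : ∀ i, 0 < G.degree i) {X Y : Finset V} (hX : X.Nonempty)
    (hXY : X ⊆ Y) {k : V} {g g' : V → ℝ} (hg : G.IsGreen X k g) (hg' : G.IsGreen Y k g')
    (v : V) : g' v ≤ g v := by
  refine sub_nonpos.1 (nonpos_of_le_stepMean hG hd (hX.mono hXY) (f := g' - g) (fun w hw => ?_)
    (fun w hw => ?_) v)
  · have := hg.nonneg hG hd hX w
    simp [hg'.eq_zero w hw, this]
  · rw [stepMean_sub, Pi.sub_apply, hg.eq_add w fun h => hw (hXY h), hg'.eq_add w hw]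
    linarith

/-- The second difference is harmonic off `insert j Y`, so only its sign on that set matters. -/
theorem IsGreen.supermodular {V : Type*} [Fintype V] [DecidableEq V] {G : WeightedDigraph V}
    (hG : G.StronglyConnected) (hd : ∀ i, 0 < G.degree i) {X Y : Finset V} (hX : X.Nonempty)
    (hXY : X ⊆ Y) {j k : V} {g g₁ g' g₁' : V → ℝ} (hg : G.IsGreen X k g)
    (hg₁ : G.IsGreen (insert j X) k g₁) (hg' : G.IsGreen Y k g')
    (hg₁' : G.IsGreen (insert j Y) k g₁') (v : V) : g' v - g₁' v ≤ g v - g₁ v := by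
  refine sub_nonpos.1 (nonpos_of_le_stepMean hG hd (Finset.insert_nonempty j Y)
    (f := (g' - g₁') - (g - g₁)) (fun w hw => ?_) (fun w hw => ?_) v)
  · simp only [Pi.sub_apply, hg₁'.eq_zero w hw]
    -- At `j` both functions killed at `j` vanish, leaving monotonicity from `X` to `Y`. On `Y` both
    -- primed functions vanish, leaving monotonicity from `X` to `insert j X`.
    rcases Finset.mem_insert.1 hw with rfl | hw
    · rw [hg₁.eq_zero w (Finset.mem_insert_self w X)]
      linarith [hg.antitone hG hd hX hXY hg' w]
    · rw [hg'.eq_zero w hw]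
      linarith [hg.antitone hG hd hX (Finset.subset_insert j X) hg₁ w]
  · have hw' : w ∉ insert j X := fun h => hw (Finset.insert_subset_insert j hXY h)
    simp only [stepMean_sub, Pi.sub_apply]
    rw [hg.eq_add w fun h => hw' (Finset.mem_insert_of_mem h), hg₁.eq_add w hw',
      hg'.eq_add w fun h => hw (Finset.mem_insert_of_mem h), hg₁'.eq_add w hw]
    linarith

/-! ### One step of the random walk -/

theorem integral_stepLaw {V : Type*} [Fintype V] [MeasurableSpace V] [MeasurableSingletonClass V]
    (G : WeightedDigraph V) {v : V} (hd : 0 < G.degree v) (f : V → ℝ) :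
    ∫ w, f w ∂G.stepLaw v = G.stepMean f v := by
  rw [stepLaw, if_neg hd.ne', integral_finsetSum_measure fun j _ =>
    (integrable_dirac (by simp)).smul_measure ENNReal.ofReal_ne_top]
  refine Finset.sum_congr rfl fun j _ => ?_
  rw [integral_smul_measure, integral_dirac, ENNReal.toReal_ofReal (G.transition_nonneg v j),
    smul_eq_mul]

instance isProbabilityMeasure_walkLaw {V : Type*} [Fintype V] [MeasurableSpace V]
    [MeasurableSingletonClass V] (G : WeightedDigraph V) (i : V) :
    IsProbabilityMeasure (G.walkLaw i) := by
  unfold walkLaw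
  infer_instance

theorem integrable_walkLaw {V : Type*} [Fintype V] [MeasurableSpace V]
    [MeasurableSingletonClass V] (G : WeightedDigraph V) (i : V) (n : ℕ) (f : V → ℝ) :
    Integrable (fun ω => f (ω n)) (G.walkLaw i) :=
  Integrable.comp_measurable (g := f) (f := fun ω : ℕ → V => ω n) Integrable.of_finite
    (measurable_pi_apply n)

theorem integral_walkLaw_zero {V : Type*} [Fintype V] [MeasurableSpace V]
    [MeasurableSingletonClass V] (G : WeightedDigraph V) (i : V) (f : V → ℝ) :
    ∫ ω, f (ω 0) ∂G.walkLaw i = f i := by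
  have h := (G.integrable_walkLaw i 0 f).aestronglyMeasurable
  unfold walkLaw at h ⊢
  rw [Kernel.integral_traj _ h]
  simp [Function.updateFinset]

/-- The Markov property at time `n`. -/
theorem setIntegral_walkLaw_succ {V : Type*} [Fintype V] [MeasurableSpace V]
    [MeasurableSingletonClass V] (G : WeightedDigraph V) (hd : ∀ i, 0 < G.degree i) (i : V)
    (n : ℕ) (S : Set (Finset.Iic n → V)) (f : V → ℝ) :
    ∫ ω in Preorder.frestrictLe (π := fun _ => V) n ⁻¹' S, f (ω (n + 1)) ∂G.walkLaw i =
      ∫ ω in Preorder.frestrictLe (π := fun _ => V) n ⁻¹' S, G.stepMean f (ω n) ∂G.walkLaw i := by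
  have hS : MeasurableSet S := S.toFinite.measurableSet
  have hmeas : Measurable (Preorder.frestrictLe (π := fun _ => V) n) :=
    Preorder.measurable_frestrictLe n
  -- The joint law of the path up to `n` and the next vertex is the law of the path composed with
  -- the step kernel; integrating out the next vertex turns `f` into its step mean.
  have hprod := Kernel.partialTraj_compProd_eq_map_traj (X := fun _ => V) (κ := G.stepKernel)
    (Nat.zero_le n) (x₀ := fun _ => i)
  have hmap := Kernel.traj_map_frestrictLe_apply (X := fun _ => V) (κ := G.stepKernel) 0 n
    (fun _ => i)
  let F : (Finset.Iic n → V) × V → ℝ := fun p => S.indicator (fun _ => f p.2) p.1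
  let g : (Finset.Iic n → V) → ℝ :=
    S.indicator fun x => G.stepMean f (x ⟨n, Finset.mem_Iic.2 le_rfl⟩)
  have hF : Measurable F := measurable_of_finite F
  have hg : Measurable g := measurable_of_finite g
  rw [← integral_indicator (hmeas hS), ← integral_indicator (hmeas hS)]
  calc _ = ∫ p, F p ∂(G.walkLaw i).map fun ω => (Preorder.frestrictLe n ω, ω (n + 1)) := by
        rw [integral_map (by fun_prop) hF.aestronglyMeasurable]
        rfl
    _ = ∫ x, g x ∂(G.walkLaw i).map (Preorder.frestrictLe n) := by
        rw [walkLaw, ← hprod, Measure.integral_compProd (Integrable.of_finite), hmap]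
        refine integral_congr_ae (ae_of_all _ fun x => ?_)
        by_cases hx : x ∈ S
        · simp only [F, g, Set.indicator_of_mem hx]
          exact G.integral_stepLaw (hd _) f
        · simp [F, g, hx]
    _ = _ := by
        rw [integral_map (by fun_prop) hg.aestronglyMeasurable]
        rfl

/-! ### Escape probabilities -/

/-- The trajectories that avoid `A` at the times from `1` to `n`. -/
def avoiding {V : Type*} (A : Set V) (n : ℕ) : Set (ℕ → V) :=
  {ω | ∀ s, 1 ≤ s → s ≤ n → ω s ∉ A}

theorem avoiding_zero {V : Type*} (A : Set V) : avoiding A 0 = Set.univ := by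
  ext ω
  simp only [avoiding, Set.mem_ofPred_eq, Set.mem_univ, iff_true]
  omega

theorem mem_avoiding_succ {V : Type*} {A : Set V} {n : ℕ} {ω : ℕ → V} :
    ω ∈ avoiding A (n + 1) ↔ ω ∈ avoiding A n ∧ ω (n + 1) ∉ A := by
  constructor
  · exact fun h => ⟨fun s h1 h2 => h s h1 (by omega), h _ (by omega) le_rfl⟩
  · rintro ⟨h, h'⟩ s h1 h2
    rcases Nat.lt_or_ge n s with h3 | h3
    · rwa [show s = n + 1 by omega]
    · exact h s h1 h3

theorem avoiding_eq_preimage {V : Type*} (A : Set V) (n : ℕ) :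
    avoiding A n = Preorder.frestrictLe (π := fun _ => V) n ⁻¹'
      {x | ∀ s : Finset.Iic n, 1 ≤ (s : ℕ) → x s ∉ A} := by
  ext ω
  exact ⟨fun h s h1 => h s h1 (Finset.mem_Iic.1 s.2),
    fun h s h1 h2 => h ⟨s, Finset.mem_Iic.2 h2⟩ h1⟩

theorem measurableSet_avoiding {V : Type*} [Fintype V] [MeasurableSpace V]
    [MeasurableSingletonClass V] (A : Set V) (n : ℕ) : MeasurableSet (avoiding A n) := by
  rw [avoiding_eq_preimage]
  exact Preorder.measurable_frestrictLe n (Set.toFinite _).measurableSet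

theorem setIntegral_avoiding_succ {V : Type*} [Fintype V] [MeasurableSpace V]
    [MeasurableSingletonClass V] (G : WeightedDigraph V) (hd : ∀ i, 0 < G.degree i) (i : V)
    (A : Set V) (n : ℕ) (f : V → ℝ) :
    ∫ ω in avoiding A n, G.stepMean f (ω n) ∂G.walkLaw i =
      ∫ ω in avoiding A n, f (ω (n + 1)) ∂G.walkLaw i := by
  rw [avoiding_eq_preimage, G.setIntegral_walkLaw_succ hd]

/-- The walk reaches every nonempty set almost surely. -/
theorem tendsto_measureReal_avoiding {V : Type*} [Fintype V] [MeasurableSpace V]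
    [MeasurableSingletonClass V] {G : WeightedDigraph V} (hG : G.StronglyConnected)
    (hd : ∀ i, 0 < G.degree i) (i : V) {A : Finset V} (hA : A.Nonempty) :
    Filter.Tendsto (fun n => (G.walkLaw i).real (avoiding (A : Set V) n)) Filter.atTop
      (nhds 0) := by
  -- `u` is the mean hitting time of `A`.
  obtain ⟨u, hu0, hu1⟩ := exists_dirichlet hG hd hA fun _ => 1
  have hu : ∀ v, 0 ≤ u v := fun v => by
    have := nonpos_of_le_stepMean hG hd hA (f := (-1 : ℝ) • u) (fun v hv => by simp [hu0 v hv])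
      (fun v hv => by
        rw [stepMean_smul, Pi.smul_apply, smul_eq_mul, hu1 v hv]
        linarith) v
    simpa using this
  set p : ℕ → ℝ := fun n => (G.walkLaw i).real (avoiding (A : Set V) n) with hp
  set U : ℕ → ℝ := fun n => ∫ ω in avoiding (A : Set V) n, G.stepMean u (ω n) ∂G.walkLaw i with hU
  have hU0 : ∀ n, 0 ≤ U n := fun n => integral_nonneg fun ω => G.stepMean_nonneg hu _
  -- At time `n + 1` either `A` is hit and `u = 0`, or `u = 1 + P u`. Telescoping bounds the sum of
  -- the avoidance probabilities by `U 0`, so they tend to zero.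
  have hstep : ∀ n, U n = p (n + 1) + U (n + 1) := fun n => by
    have h1 : p (n + 1) = ∫ ω in avoiding (A : Set V) (n + 1), (1 : ℝ) ∂G.walkLaw i := by
      simp [hp, measureReal_def]
    rw [h1]
    simp only [hU]
    rw [G.setIntegral_avoiding_succ hd, ← integral_add (integrable_const _)
        (G.integrable_walkLaw i (n + 1) _).integrableOn,
      ← integral_indicator (measurableSet_avoiding _ _),
      ← integral_indicator (measurableSet_avoiding _ _)]
    refine integral_congr_ae (ae_of_all _ fun ω => ?_)
    by_cases h : ω ∈ avoiding (A : Set V) n <;> by_cases h' : ω (n + 1) ∈ A <;>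
      simp [Set.indicator, mem_avoiding_succ, h, h']
    · exact hu0 _ h'
    · exact hu1 _ h'
  have hsum : ∀ n, ∑ k ∈ Finset.range n, p (k + 1) = U 0 - U n := fun n => by
    induction n with
    | zero => simp
    | succ n ih =>
      rw [Finset.sum_range_succ, ih]
      linarith [hstep n]
  have hs : Summable fun n => p (n + 1) :=
    summable_of_sum_range_le (c := U 0) (fun n => measureReal_nonneg)
      fun n => by linarith [hsum n, hU0 n]
  exact (Filter.tendsto_add_atTop_iff_nat 1).1 hs.tendsto_atTop_zero

/-- The trajectories that reach `X` before they return to `i`. -/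
def escaping {V : Type*} (i : V) (X : Finset V) : Set (ℕ → V) :=
  {ω | ∃ t, 1 ≤ t ∧ ω t ∈ X ∧ ∀ s, 1 ≤ s → s ≤ t → ω s ≠ i}

theorem measurableSet_escaping {V : Type*} [Fintype V] [MeasurableSpace V]
    [MeasurableSingletonClass V] (i : V) (X : Finset V) : MeasurableSet (escaping i X) := by
  have h : escaping i X = ⋃ t, ⋃ _ : 1 ≤ t,
      (fun ω : ℕ → V => ω t) ⁻¹' (X : Set V) ∩ avoiding {i} t := by
    ext ω
    simp [escaping, avoiding, and_left_comm]
  rw [h]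
  exact MeasurableSet.iUnion fun t => MeasurableSet.iUnion fun _ =>
    (measurable_pi_apply t X.measurableSet).inter (measurableSet_avoiding _ _)

theorem mem_escaping_of_avoiding {V : Type*} [DecidableEq V] {i : V} {X : Finset V} {n : ℕ}
    {ω : ℕ → V} (h : ω ∈ avoiding (insert i X : Finset V) n) (hn : ω (n + 1) ∈ X) (hi : i ∉ X) :
    ω ∈ escaping i X := by
  refine ⟨n + 1, by omega, hn, fun s h1 h2 h3 => ?_⟩
  rcases Nat.lt_or_ge n s with h4 | h4
  · rw [show s = n + 1 by omega] at h3
    exact hi (h3 ▸ hn)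
  · exact h s h1 h4 (by simp [h3])

theorem notMem_escaping_of_avoiding {V : Type*} [DecidableEq V] {i : V} {X : Finset V} {n : ℕ}
    {ω : ℕ → V} (h : ω ∈ avoiding (insert i X : Finset V) n) (hn : ω (n + 1) = i) :
    ω ∉ escaping i X := by
  rintro ⟨t, h1, h2, h3⟩
  rcases Nat.lt_or_ge n t with h4 | h4
  · exact h3 (n + 1) (by omega) h4 hn
  · exact h t h1 h4 (by simp [h2])

/-- If `h` is `1` on `X`, `0` at `i` and harmonic elsewhere, then the mean of `h` after one step
from `i` is the probability that the walk reaches `X` before it returns to `i`. -/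
theorem escapeProb_eq_stepMean {V : Type*} [Fintype V] [DecidableEq V] [MeasurableSpace V]
    [MeasurableSingletonClass V] {G : WeightedDigraph V} (hG : G.StronglyConnected)
    (hd : ∀ i, 0 < G.degree i) {i : V} {X : Finset V} (hi : i ∉ X) {h : V → ℝ}
    (hX : ∀ v ∈ X, h v = 1) (h0 : h i = 0) (hh : ∀ v ∉ X, v ≠ i → h v = G.stepMean h v) :
    G.escapeProb i X = G.stepMean h i := by
  -- Avoidance is tested only from time `1`, so the start at `i ∈ A` does no harm.
  set A : Finset V := insert i X with hAdef
  have hA : ∀ v, v ∈ A ↔ v = i ∨ v ∈ X := fun v => Finset.mem_insert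
  set μ := G.walkLaw i
  let E : Set (ℕ → V) := escaping i X
  have hE : MeasurableSet E := measurableSet_escaping i X
  let a : ℕ → ℝ := fun n => ∫ ω in avoiding (A : Set V) n, G.stepMean h (ω n) ∂μ
  let b : ℕ → ℝ := fun n => μ.real (E ∩ avoiding (A : Set V) n)
  have hEA : ∀ n, MeasurableSet (E ∩ avoiding (A : Set V) n) := fun n =>
    hE.inter (measurableSet_avoiding _ _)
  have hint : ∀ n (f : V → ℝ) m,
      Integrable ((avoiding (A : Set V) n).indicator fun ω => f (ω m)) μ := fun n f m =>
    (G.integrable_walkLaw i m f).indicator (measurableSet_avoiding _ _)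
  have hintE : ∀ n, Integrable ((E ∩ avoiding (A : Set V) n).indicator (1 : (ℕ → V) → ℝ)) μ :=
    fun n => (integrable_const 1).indicator (hEA n)
  -- Optional stopping by hand. If the walk first hits `A` at time `n + 1`, then `h` is exactly the
  -- indicator of `E`: `1` in `X`, `0` at `i`. If it does not hit `A`, harmonicity passes `h` on to
  -- the next step.
  have hstep : ∀ n, a n - b n = a (n + 1) - b (n + 1) := fun n => by
    simp only [a, b]
    rw [G.setIntegral_avoiding_succ hd, ← integral_indicator (measurableSet_avoiding _ _),
      ← integral_indicator (measurableSet_avoiding _ _), ← integral_indicator_one (hEA n),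
      ← integral_indicator_one (hEA (n + 1)), ← integral_sub (hint _ _ _) (hintE _),
      ← integral_sub (hint _ _ _) (hintE _)]
    refine integral_congr_ae (ae_of_all _ fun ω => ?_)
    by_cases hω : ω ∈ avoiding (A : Set V) n
    · by_cases h1 : ω (n + 1) ∈ X
      · have h2 : ω ∈ E := mem_escaping_of_avoiding hω h1 hi
        simp [Set.indicator, mem_avoiding_succ, hω, hA, h1, h2, hX]
      · by_cases h3 : ω (n + 1) = i
        · have h2 : ω ∉ E := notMem_escaping_of_avoiding hω h3
          simp [Set.indicator, mem_avoiding_succ, hω, hA, h2, h3, h0]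
        · by_cases h2 : ω ∈ E <;>
            simp [Set.indicator, mem_avoiding_succ, hω, hA, h1, h2, h3, hh _ h1 h3]
    · simp [Set.indicator, mem_avoiding_succ, hω]
  have hconst : ∀ n, a n - b n = a 0 - b 0 := fun n => by
    induction n with
    | zero => rfl
    | succ n ih => rw [← hstep, ih]
  have hp := tendsto_measureReal_avoiding hG hd i (Finset.insert_nonempty i X)
  rw [← hAdef] at hp
  have hb : Filter.Tendsto b Filter.atTop (nhds 0) :=
    squeeze_zero (fun n => measureReal_nonneg) (fun n => measureReal_mono Set.inter_subset_right) hp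
  obtain ⟨C, hC⟩ := (Set.finite_range fun v => ‖G.stepMean h v‖).bddAbove
  have ha : Filter.Tendsto a Filter.atTop (nhds 0) := by
    refine squeeze_zero_norm (fun n => norm_setIntegral_le_of_norm_le_const (C := C)
      (measure_lt_top _ _) fun ω _ => hC ⟨ω n, rfl⟩) ?_
    simpa using hp.const_mul C
  -- The conserved difference is zero because both terms vanish in the limit: `A` is hit almost
  -- surely and the step mean of `h` is bounded.
  have h1 : a 0 - b 0 = 0 := by
    refine tendsto_nhds_unique (tendsto_const_nhds (f := Filter.atTop (α := ℕ))) ?_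
    have := ha.sub hb
    simp only [hconst, sub_zero] at this
    exact this
  have ha0 : a 0 = G.stepMean h i := by
    simp only [a, avoiding_zero, Measure.restrict_univ]
    exact G.integral_walkLaw_zero i (G.stepMean h)
  have hb0 : b 0 = G.escapeProb i X := by
    simp only [b, avoiding_zero, Set.inter_univ]
    rfl
  linarith

/-- The escape probability is the reciprocal of the mean number of visits to the starting
vertex. -/
theorem IsGreen.escapeProb_eq_inv {V : Type*} [Fintype V] [DecidableEq V] [MeasurableSpace V]
    [MeasurableSingletonClass V] {G : WeightedDigraph V} (hG : G.StronglyConnected)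
    (hd : ∀ i, 0 < G.degree i) {i : V} {X : Finset V} (hX : X.Nonempty) (hi : i ∉ X)
    {g : V → ℝ} (hg : G.IsGreen X i g) : G.escapeProb i X = (g i)⁻¹ := by
  have hgi : g i = 1 + G.stepMean g i := by simpa using hg.eq_add i hi
  have hpos : g i ≠ 0 := by
    linarith [G.stepMean_nonneg (hg.nonneg hG hd hX) i]
  have hmean : ∀ v, G.stepMean ((fun _ => 1) - (g i)⁻¹ • g) v = 1 - (g i)⁻¹ * G.stepMean g v :=
    fun v => by rw [stepMean_sub, stepMean_smul, G.stepMean_const _ (hd v)]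
  -- `1 - g / g i` has the required boundary values and is harmonic elsewhere, since the only source
  -- of `g` is at `i`. Its step mean at `i` is `1 - (g i - 1) / g i = 1 / g i`.
  rw [escapeProb_eq_stepMean hG hd hi (h := (fun _ => 1) - (g i)⁻¹ • g), hmean]
  · field_simp
    linarith
  · intro v hv
    simp [hg.eq_zero v hv]
  · simp [hpos]
  · intro v hv hvi
    have := hg.eq_add v hv
    simp only [hvi, if_false, zero_add] at this
    rw [hmean, ← this]
    simp

theorem IsGreen.resistance_eq {V : Type*} [Fintype V] [DecidableEq V] [MeasurableSpace V]
    [MeasurableSingletonClass V] {G : WeightedDigraph V} (hG : G.StronglyConnected)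
    (hd : ∀ i, 0 < G.degree i) {i : V} {X : Finset V} (hX : X.Nonempty)
    {g : V → ℝ} (hg : G.IsGreen X i g) :
    G.resistance i X = (G.volume * G.stationary i)⁻¹ * g i := by
  rw [resistance]
  split_ifs with hi
  · rw [hg.eq_zero i hi, mul_zero]
  · rw [hg.escapeProb_eq_inv hG hd hX hi, one_div, mul_inv, inv_inv]

theorem volume_mul_stationary_nonneg {V : Type*} [Fintype V] [Nonempty V]
    (G : WeightedDigraph V) (hd : ∀ i, 0 < G.degree i) (i : V) :
    0 ≤ G.volume * G.stationary i :=
  mul_nonneg (Finset.sum_nonneg fun i _ => (hd i).le) ((G.isStationary_stationary hd).nonneg i)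

/-- A single vertex may have degree `0`, so the Green function argument is not available; but there
a nonempty group contains every vertex. -/
theorem groupResistance_eq_zero {V : Type*} [Fintype V] [DecidableEq V] [MeasurableSpace V]
    [MeasurableSingletonClass V] [Subsingleton V] (G : WeightedDigraph V) {X : Finset V}
    (hX : X.Nonempty) : G.groupResistance X = 0 := by
  obtain ⟨x, hx⟩ := hX
  exact Finset.sum_eq_zero fun i _ => if_pos (Subsingleton.elim x i ▸ hx)

end WeightedDigraph

open WeightedDigraph in
theorem mainTheorem8 {V : Type*} [Fintype V] [DecidableEq V] [MeasurableSpace V]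
    [MeasurableSingletonClass V] (G : WeightedDigraph V) (hG : G.StronglyConnected) :
    (∀ X Y : Finset V, X.Nonempty → X ⊆ Y → G.groupResistance X ≥ G.groupResistance Y) ∧
    (∀ X Y : Finset V, X.Nonempty → X ⊆ Y → ∀ i : V,
      G.groupResistance X - G.groupResistance (insert i X) ≥
        G.groupResistance Y - G.groupResistance (insert i Y)) := by
  rcases subsingleton_or_nontrivial V with hV | hV
  · refine ⟨fun X Y hX hXY => ?_, fun X Y hX hXY i => ?_⟩
    · rw [G.groupResistance_eq_zero hX, G.groupResistance_eq_zero (hX.mono hXY)]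
    · rw [G.groupResistance_eq_zero hX, G.groupResistance_eq_zero (hX.mono hXY),
        G.groupResistance_eq_zero (Finset.insert_nonempty i X),
        G.groupResistance_eq_zero (Finset.insert_nonempty i Y)]
  have hd : ∀ i, 0 < G.degree i := fun i => hG.degree_pos i
  have hc : ∀ i, 0 ≤ (G.volume * G.stationary i)⁻¹ := fun i =>
    inv_nonneg.2 (G.volume_mul_stationary_nonneg hd i)
  refine ⟨fun X Y hX hXY => Finset.sum_le_sum fun k _ => ?_, fun X Y hX hXY i => ?_⟩
  · obtain ⟨g, hg⟩ := exists_isGreen hG hd hX k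
    obtain ⟨g', hg'⟩ := exists_isGreen hG hd (hX.mono hXY) k
    rw [hg.resistance_eq hG hd hX, hg'.resistance_eq hG hd (hX.mono hXY)]
    exact mul_le_mul_of_nonneg_left (hg.antitone hG hd hX hXY hg' k) (hc k)
  · simp only [groupResistance, ← Finset.sum_sub_distrib]
    refine Finset.sum_le_sum fun k _ => ?_
    obtain ⟨g, hg⟩ := exists_isGreen hG hd hX k
    obtain ⟨g', hg'⟩ := exists_isGreen hG hd (hX.mono hXY) k
    obtain ⟨g₁, hg₁⟩ := exists_isGreen hG hd (Finset.insert_nonempty i X) k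
    obtain ⟨g₁', hg₁'⟩ := exists_isGreen hG hd (Finset.insert_nonempty i Y) k
    rw [hg.resistance_eq hG hd hX, hg'.resistance_eq hG hd (hX.mono hXY),
      hg₁.resistance_eq hG hd (Finset.insert_nonempty i X),
      hg₁'.resistance_eq hG hd (Finset.insert_nonempty i Y), ← mul_sub, ← mul_sub]
    exact mul_le_mul_of_nonneg_left (hg.supermodular hG hd hX hXY hg₁ hg' hg₁' k) (hc k)
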